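/- A real matrix is totally positive (TP) if all its minors are positive. Let $A\in\mathbb{R}^{n\times n}$ be TP, let $g:\mathbb{R}^n\to\mathbb{R}^n$ be $C^1$, and let $\Omega\subset\mathbb{R}^n$ be compact and convex. For $\varepsilon\ge 0$ consider the system $$x(k+1)=f_\varepsilon(x(k)),\qquad f_\varepsilon(x):=Ax+\varepsilon g(x),$$ and let $J_\varepsilon(x)=A+\varepsilon\,\frac{\partial g}{\partial x}(x)$ be the Jacobian of $f_\varepsilon$. Let $D_\pm\in\mathbb{R}^{n\times n}$ be the diagonal matrix with diagonal entries $(-1)^{i+1}$, $i=1,\dots,n$, and for $X,Y\in\mathbb{R}^{n\times n}$ write $X\le^\dagger Y$ if $D_\pm XD_\pm\le D_\pm YD_\pm$ entrywise. Define $B\in\mathbb{R}^{n\times n}$ by $$b_{ij}:=\max_{x\in\Omega}\left|\frac{\partial g_i(x)}{\partial x_j}\right|$$ (with $b_{ij}:=0$ if $\Omega=\emptyset$) and $$P(v):=A-vD_\pm BD_\pm,\qquad Q(v):=A+vD_\pm BD_\pm .$$ Then there exists $w>0$ such that: 1. for every $v\in[0,w)$ the matrices $P(v)$ and $Q(v)$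 are TP, and for every $\varepsilon\in[0,v]$ and every $x\in\Omega$, $$P(v)\le^\dagger J_\varepsilon(x)\le^\dagger Q(v);$$ 2. for every $\varepsilon\in[0,w)$ for which the trajectories of the system evolve on $\Omega$, that is, $f_\varepsilon(\Omega)\subseteq\Omega$, every solution with $x(0)\in\Omega$ converges to an equilibrium point, that is, to some $e\in\Omega$ with $f_\varepsilon(e)=e$. -/

import Mathlib

open Filter Topology Set

noncomputable section

/-- A real matrix is totally positive if all its minors are positive. -/
def IsTotallyPositive {m n : ℕ} (A : Matrix (Fin m) (Fin n) ℝ) : Prop :=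
  ∀ (k : ℕ) (r : Fin k ↪o Fin m) (c : Fin k ↪o Fin n), 0 < (A.submatrix r c).det

/-- The diagonal matrix `diag(1, -1, 1, -1, …)`. -/
def signDiag (n : ℕ) : Matrix (Fin n) (Fin n) ℝ :=
  Matrix.diagonal fun i => (-1 : ℝ) ^ (i : ℕ)

/-- The checkerboard partial order: `D A D ≤ D B D` entrywise, with `D = diag(1, -1, 1, …)`. -/
def CheckerboardLE {n : ℕ} (A B : Matrix (Fin n) (Fin n) ℝ) : Prop :=
  ∀ i j, (signDiag n * A * signDiag n) i j ≤ (signDiag n * B * signDiag n) i j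

/-- The Jacobian matrix of `f` at `x`, with `(i, j)` entry `∂f_i / ∂x_j`. -/
def jacobianMatrix {n : ℕ} (f : (Fin n → ℝ) → (Fin n → ℝ)) (x : Fin n → ℝ) :
    Matrix (Fin n) (Fin n) ℝ :=
  Matrix.of fun i j => fderiv ℝ f x (Pi.single j 1) i

/-- The matrix with `(i, j)` entry `max_{x ∈ Ω} |∂g_i / ∂x_j|`, written as a supremum
(attained when `g` is `C¹` and `Ω` is compact and nonempty; zero when `Ω` is empty). -/
def jacobianBound {n : ℕ} (g : (Fin n → ℝ) → (Fin n → ℝ)) (Ω : Set (Fin n → ℝ)) :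
    Matrix (Fin n) (Fin n) ℝ :=
  Matrix.of fun i j => sSup ((fun x => |jacobianMatrix g x i j|) '' Ω)

/-- The supremum in `jacobianBound` is a maximum. -/
theorem jacobianBound_isGreatest {n : ℕ} {g : (Fin n → ℝ) → (Fin n → ℝ)}
    {Ω : Set (Fin n → ℝ)} (hg : ContDiff ℝ 1 g) (hΩ : IsCompact Ω) (hne : Ω.Nonempty)
    (i j : Fin n) :
    IsGreatest ((fun x => |jacobianMatrix g x i j|) '' Ω) (jacobianBound g Ω i j) := by
  have h1 : Continuous (fderiv ℝ g) := hg.continuous_fderiv one_ne_zero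
  have h2 : Continuous fun x => |jacobianMatrix g x i j| := by
    simp only [jacobianMatrix, Matrix.of_apply]
    fun_prop
  exact (hΩ.image h2).isGreatest_sSup (hne.image _)

/-- `P(v) = A - v D B D`. -/
def lowerMatrix {n : ℕ} (A B : Matrix (Fin n) (Fin n) ℝ) (v : ℝ) : Matrix (Fin n) (Fin n) ℝ :=
  A - v • (signDiag n * B * signDiag n)

/-- `Q(v) = A + v D B D`. -/
def upperMatrix {n : ℕ} (A B : Matrix (Fin n) (Fin n) ℝ) (v : ℝ) : Matrix (Fin n) (Fin n) ℝ :=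
  A + v • (signDiag n * B * signDiag n)

/-- The right-hand side `x ↦ A x + ε g(x)` of the perturbed linear system. -/
def perturbedMap {n : ℕ} (A : Matrix (Fin n) (Fin n) ℝ) (g : (Fin n → ℝ) → (Fin n → ℝ))
    (ε : ℝ) (x : Fin n → ℝ) : Fin n → ℝ :=
  A.mulVec x + ε • g x

end

/-! Total positivity is an open condition, so small ε leaves room for part 1, and every matrix
within the same entrywise bound is TP. By the mean value theorem on the convex set Ω, f y - f x = M
(y - x) with M TP. The increments of an orbit thus evolve by TP matrices.

TP matrices diminish variation: the number of sign blocks of a vector cannot grow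
(`IsTotallyPositive.hasSignPattern_le`), and if it stays equal, the leading sign is kept and the
first image coordinate is nonzero (`IsTotallyPositive.first_coordinate_pos`). A nonincreasing
natural number stabilizes, so the first coordinate of a never stationary orbit is eventually
strictly monotone, hence convergent by compactness. All cluster points share that first coordinate;
the same sign argument shows that they are fixed and that there is only one. -/

/-! ### Determinants of products with a totally positive factor. -/

/-- Expansion of the determinant of a product along the columns of the right factor. -/
theorem det_submatrix_mul_eq_sum {m n k : ℕ} (A : Matrix (Fin m) (Fin n) ℝ) (r : Fin k → Fin m)
    (W : Matrix (Fin n) (Fin k) ℝ) :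
    (A.submatrix r id * W).det = ∑ s : Fin k → Fin n, (∏ j, W (s j) j) * (A.submatrix r s).det := by
  have h := (Matrix.detRowAlternating (n := Fin k) (R := ℝ)).toMultilinearMap.map_sum
    (fun (j : Fin k) (i : Fin n) (a : Fin k) => W i j * A (r a) i)
  have h1 : (A.submatrix r id * W).det = Matrix.detRowAlternating
      (fun j : Fin k => ∑ i : Fin n, fun a : Fin k => W i j * A (r a) i) := by
    rw [← Matrix.det_transpose]
    change Matrix.det _ = Matrix.det _
    congr 1
    ext j a
    simp [Matrix.mul_apply, mul_comm]
  rw [h1]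
  refine h.trans (Finset.sum_congr rfl fun s _ => ?_)
  rw [← Matrix.det_transpose (A.submatrix r s), ← Matrix.det_mul_column]
  rfl

theorem IsTotallyPositive.det_submatrix_pos {m n k : ℕ} {A : Matrix (Fin m) (Fin n) ℝ}
    (hA : IsTotallyPositive A) {r : Fin k → Fin m} {s : Fin k → Fin n} (hr : StrictMono r)
    (hs : StrictMono s) : 0 < (A.submatrix r s).det :=
  hA k (OrderEmbedding.ofStrictMono r hr) (OrderEmbedding.ofStrictMono s hs)

/-- The supports of the columns of `W` are ordered from left to right. -/
def HasOrderedColumns {n k : ℕ} (W : Matrix (Fin n) (Fin k) ℝ) : Prop :=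
  ∀ ⦃j j'⦄, j < j' → ∀ ⦃i i'⦄, W i j ≠ 0 → W i' j' ≠ 0 → i < i'

/-- A nonzero product selects `s j` in the support of column `j`; ordered supports then make `s`
strictly increasing, so the other factor is a genuine minor. -/
theorem IsTotallyPositive.summand_nonneg {m n k : ℕ} {A : Matrix (Fin m) (Fin n) ℝ}
    (hA : IsTotallyPositive A) {r : Fin k → Fin m} (hr : StrictMono r)
    {W : Matrix (Fin n) (Fin k) ℝ} (hW : ∀ i j, 0 ≤ W i j) (ho : HasOrderedColumns W)
    (s : Fin k → Fin n) : 0 ≤ (∏ j, W (s j) j) * (A.submatrix r s).det := by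
  by_cases h : ∀ j, W (s j) j ≠ 0
  · have hs : StrictMono s := fun j j' hj => ho hj (h j) (h j')
    exact mul_nonneg (Finset.prod_nonneg fun j _ => hW _ _) (hA.det_submatrix_pos hr hs).le
  · push Not at h
    obtain ⟨j, hj⟩ := h
    have h0 : ∏ j, W (s j) j = 0 := Finset.prod_eq_zero (Finset.mem_univ j) hj
    exact (mul_eq_zero_of_left h0 _).ge

theorem IsTotallyPositive.det_submatrix_mul_nonneg {m n k : ℕ} {A : Matrix (Fin m) (Fin n) ℝ}
    (hA : IsTotallyPositive A) {r : Fin k → Fin m} (hr : StrictMono r)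
    {W : Matrix (Fin n) (Fin k) ℝ} (hW : ∀ i j, 0 ≤ W i j) (ho : HasOrderedColumns W) :
    0 ≤ (A.submatrix r id * W).det := by
  rw [det_submatrix_mul_eq_sum]
  exact Finset.sum_nonneg fun s _ => hA.summand_nonneg hr hW ho s

theorem IsTotallyPositive.det_submatrix_mul_pos {m n k : ℕ} {A : Matrix (Fin m) (Fin n) ℝ}
    (hA : IsTotallyPositive A) {r : Fin k → Fin m} (hr : StrictMono r)
    {W : Matrix (Fin n) (Fin k) ℝ} (hW : ∀ i j, 0 ≤ W i j) (ho : HasOrderedColumns W)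
    (hne : ∀ j, ∃ i, W i j ≠ 0) : 0 < (A.submatrix r id * W).det := by
  rw [det_submatrix_mul_eq_sum]
  choose s hs using hne
  refine Finset.sum_pos' (fun s _ => hA.summand_nonneg hr hW ho s) ⟨s, Finset.mem_univ s, ?_⟩
  exact mul_pos (Finset.prod_pos fun j _ => (hW _ _).lt_of_ne' (hs j))
    (hA.det_submatrix_pos hr fun j j' hj => ho hj (hs j) (hs j'))

/-! ### Sign blocks and variation diminishing. -/

/-- A partition of the coordinates of `z` into `k + 1` consecutive nonzero blocks of alternating
weak sign, the first one having the sign `σ`. -/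
def HasSignPattern {n : ℕ} (z : Fin n → ℝ) (k : ℕ) (σ : ℝ) : Prop :=
  ∃ b : Fin n → ℕ, Monotone b ∧ (∀ i, b i ≤ k) ∧ (∀ i, 0 ≤ σ * (-1) ^ b i * z i) ∧
    ∀ j ≤ k, ∃ i, b i = j ∧ z i ≠ 0

/-- A prepended entry joins the first block if it is zero or has its sign, and otherwise opens a new
block. A zero tail has no block to compare with. -/
theorem exists_hasSignPattern : ∀ {n : ℕ} (z : Fin n → ℝ), z ≠ 0 →
    ∃ (k : ℕ) (σ : ℝ), (σ = 1 ∨ σ = -1) ∧ HasSignPattern z k σ := by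
  intro n
  induction n with
  | zero => exact fun z hz => (hz (Subsingleton.elim _ _)).elim
  | succ n ih =>
    intro z hz
    by_cases ht : Fin.tail z = 0
    · have h0 : ∀ i : Fin n, z i.succ = 0 := fun i => congrFun ht i
      have hz0 : z 0 ≠ 0 := fun h => hz (funext fun i => Fin.cases h h0 i)
      have key : ∀ σ : ℝ, 0 ≤ σ * z 0 → HasSignPattern z 0 σ := fun σ hσ =>
        ⟨fun _ => 0, monotone_const, fun _ => le_rfl,
          fun i => Fin.cases (by simpa using hσ) (fun i => by simp [h0]) i,
          fun j hj => ⟨0, (Nat.le_zero.mp hj).symm, hz0⟩⟩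
      rcases le_total 0 (z 0) with h | h
      · exact ⟨0, 1, Or.inl rfl, key 1 (by simpa using h)⟩
      · exact ⟨0, -1, Or.inr rfl, key (-1) (by simpa using h)⟩
    · obtain ⟨k, σ, hσ, b, hmono, hle, hsign, hne⟩ := ih _ ht
      rcases le_or_gt 0 (σ * z 0) with h | h
      · refine ⟨k, σ, hσ, Fin.cons 0 b, ?_, ?_, ?_, ?_⟩
        · intro i j hij
          cases i using Fin.cases with
          | zero => simp
          | succ i =>
            cases j using Fin.cases with
            | zero => simp at hij
            | succ j => simpa using hmono (by simpa using hij)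
        · exact fun i => Fin.cases (by simp) (fun i => by simpa using hle i) i
        · exact fun i => Fin.cases (by simpa using h) (fun i => by simpa [Fin.tail] using hsign i) i
        · intro j hj
          obtain ⟨i, hi⟩ := hne j hj
          exact ⟨i.succ, by simpa [Fin.tail] using hi⟩
      · refine ⟨k + 1, -σ, by rcases hσ with rfl | rfl <;> simp, Fin.cons 0 fun i => b i + 1,
          ?_, ?_, ?_, ?_⟩
        · intro i j hij
          cases i using Fin.cases with
          | zero => simp
          | succ i =>
            cases j using Fin.cases with
            | zero => simp at hij
            | succ j => simpa using hmono (by simpa using hij)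
        · exact fun i => Fin.cases (by simp) (fun i => by simpa using hle i) i
        · refine fun i => Fin.cases (by simpa using h.le) (fun i => ?_) i
          simpa [pow_succ, Fin.tail] using hsign i
        · intro j hj
          cases j with
          | zero => exact ⟨0, by simp, fun h0 => by simp [h0] at h⟩
          | succ j =>
            obtain ⟨i, hi⟩ := hne j (by omega)
            exact ⟨i.succ, by simpa [Fin.tail] using hi⟩

theorem HasSignPattern.exists_strictMono {n : ℕ} {z : Fin n → ℝ} {k : ℕ} {σ : ℝ}
    (h : HasSignPattern z k σ) (hσ : σ = 1 ∨ σ = -1) :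
    ∃ r : Fin (k + 1) → Fin n, StrictMono r ∧ ∀ j : Fin (k + 1), 0 < σ * (-1) ^ (j : ℕ) * z (r j) := by
  obtain ⟨b, hmono, -, hsign, hne⟩ := h
  choose r hr hrne using fun j : Fin (k + 1) => hne j (by omega)
  refine ⟨r, fun j j' hj => ?_, fun j => ?_⟩
  · by_contra hlt
    have := hmono (not_lt.mp hlt)
    rw [hr, hr] at this
    exact absurd hj (not_lt.mpr this)
  · have h1 := hsign (r j)
    rw [hr] at h1
    refine h1.lt_of_ne' (mul_ne_zero (mul_ne_zero ?_ (by simp)) (hrne j))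
    rcases hσ with rfl | rfl <;> simp

/-- If `A z` weakly alternates along `k + 1` rows, where `z` has `k + 1` sign blocks, then it does
so with the sign pattern of `z`. -/
theorem IsTotallyPositive.sign_nonneg {m n k : ℕ} {A : Matrix (Fin m) (Fin n) ℝ}
    (hA : IsTotallyPositive A) {z : Fin n → ℝ} {σ τ : ℝ} (hσ : σ = 1 ∨ σ = -1)
    (hz : HasSignPattern z k σ) {r : Fin (k + 1) → Fin m} (hr : StrictMono r)
    (hτ : ∀ j : Fin (k + 1), 0 ≤ τ * (-1) ^ (j : ℕ) * A.mulVec z (r j)) : 0 ≤ τ * σ := by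
  obtain ⟨b, hmono, hle, hsign, hne⟩ := hz
  -- Column `j` holds the moduli of block `j` and `c` the block signs, so that `z = W c`.
  let W : Matrix (Fin n) (Fin (k + 1)) ℝ := fun i j => if b i = j then |z i| else 0
  let c : Fin (k + 1) → ℝ := fun j => σ * (-1) ^ (j : ℕ)
  have hW : ∀ i j, 0 ≤ W i j := fun i j => by
    simp only [W]; split_ifs <;> positivity
  have hWb : ∀ {i j}, W i j ≠ 0 → b i = j := fun {i j} h => by
    by_contra hb
    exact h (if_neg hb)
  have ho : HasOrderedColumns W := by
    intro j j' hj i i' h h'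
    by_contra hlt
    have := hmono (not_lt.mp hlt)
    rw [hWb h, hWb h'] at this
    exact absurd hj (not_lt.mpr this)
  have hcol : ∀ j, ∃ i, W i j ≠ 0 := fun j => by
    obtain ⟨i, hi, hzi⟩ := hne j (by omega)
    exact ⟨i, by simpa [W, hi] using hzi⟩
  have hz : W.mulVec c = z := by
    ext i
    rw [Matrix.mulVec, dotProduct, Finset.sum_eq_single (⟨b i, by have := hle i; omega⟩ : Fin (k + 1))]
    · have h := hsign i
      simp only [W, c, if_true]
      have hs : (σ * (-1) ^ b i) = 1 ∨ (σ * (-1) ^ b i) = -1 := by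
        rcases hσ with rfl | rfl <;> rcases neg_one_pow_eq_or ℝ (b i) with h | h <;> simp [h]
      rcases hs with hs | hs <;> rw [hs] at h ⊢
      · rw [abs_of_nonneg (by linarith)]; ring
      · rw [abs_of_nonpos (by linarith)]; ring
    · intro j _ hj
      have : b i ≠ j := fun h => hj (Fin.ext h.symm)
      simp [W, this]
    · simp
  let B := A.submatrix r id * W
  have hB : 0 < B.det := hA.det_submatrix_mul_pos hr hW ho hcol
  have hBc : ∀ j, B.mulVec c j = A.mulVec z (r j) := fun j => by
    simp only [B]
    rw [← Matrix.mulVec_mulVec, hz]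
    rfl
  -- Cramer's rule recovers `c 0 = σ` from the alternating vector `B c`.
  have h1 : B.cramer (B.mulVec c) 0 = B.det * σ := by
    rw [Matrix.cramer_eq_adjugate_mulVec, Matrix.mulVec_mulVec, Matrix.adjugate_mul,
      Matrix.smul_mulVec, Matrix.one_mulVec]
    simp [c]
  rw [Matrix.cramer_apply, Matrix.det_succ_column_zero] at h1
  -- In the expansion along column 0 the cofactor signs cancel the alternation, and the remaining
  -- minors are nonnegative.
  have h2 : 0 ≤ τ * (B.det * σ) := by
    rw [← h1, Finset.mul_sum]
    refine Finset.sum_nonneg fun j _ => ?_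
    rw [Matrix.updateCol_self, hBc]
    have h3 : (B.updateCol 0 (B.mulVec c)).submatrix j.succAbove Fin.succ =
        A.submatrix (r ∘ j.succAbove) id * W.submatrix id Fin.succ := by
      ext a d
      simp [B, Matrix.mul_apply]
    rw [h3, ← mul_assoc, ← mul_assoc]
    refine mul_nonneg (hτ j) (hA.det_submatrix_mul_nonneg (hr.comp j.strictMono_succAbove)
      (fun _ _ => hW _ _) fun d d' hd i i' h h' => ho (Fin.succ_lt_succ_iff.mpr hd) h h')
  exact nonneg_of_mul_nonneg_right (by linarith : 0 ≤ B.det * (τ * σ)) hB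

/-- More blocks would give `k + 2` alternating rows; dropping the last or the first one yields
opposite leading signs, both forced to agree with `σ`. -/
theorem IsTotallyPositive.hasSignPattern_le {m n : ℕ} {A : Matrix (Fin m) (Fin n) ℝ}
    (hA : IsTotallyPositive A) {z : Fin n → ℝ} {k k' : ℕ} {σ σ' : ℝ} (hσ : σ = 1 ∨ σ = -1)
    (hσ' : σ' = 1 ∨ σ' = -1) (hz : HasSignPattern z k σ)
    (hAz : HasSignPattern (A.mulVec z) k' σ') : k' ≤ k := by
  by_contra! hk
  obtain ⟨r, hr, hpos⟩ := hAz.exists_strictMono hσ'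
  have h1 := hA.sign_nonneg (τ := σ') hσ hz
    (r := fun j => r ⟨j, by omega⟩) (fun j j' hj => hr hj) fun j => (hpos ⟨j, by omega⟩).le
  have h2 := hA.sign_nonneg (τ := -σ') hσ hz
    (r := fun j => r ⟨j + 1, by omega⟩) (fun j j' hj => hr (by simpa using hj)) fun j => by
      simpa [pow_succ] using (hpos ⟨j + 1, by omega⟩).le
  rcases hσ with rfl | rfl <;> rcases hσ' with rfl | rfl <;> linarith

theorem IsTotallyPositive.hasSignPattern_sign_eq {m n : ℕ} {A : Matrix (Fin m) (Fin n) ℝ}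
    (hA : IsTotallyPositive A) {z : Fin n → ℝ} {k : ℕ} {σ σ' : ℝ} (hσ : σ = 1 ∨ σ = -1)
    (hσ' : σ' = 1 ∨ σ' = -1) (hz : HasSignPattern z k σ)
    (hAz : HasSignPattern (A.mulVec z) k σ') : σ' = σ := by
  obtain ⟨r, hr, hpos⟩ := hAz.exists_strictMono hσ'
  have h1 := hA.sign_nonneg (τ := σ') hσ hz hr fun j => (hpos j).le
  rcases hσ with rfl | rfl <;> rcases hσ' with rfl | rfl <;> first | rfl | linarith

/-- If a totally positive matrix preserves the number of sign blocks of `z`, then the first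
coordinate of `A z` is nonzero, with the sign of the first block. -/
theorem IsTotallyPositive.first_coordinate_pos {m n : ℕ} {A : Matrix (Fin (m + 1)) (Fin n) ℝ}
    (hA : IsTotallyPositive A) {z : Fin n → ℝ} {k : ℕ} {σ : ℝ} (hσ : σ = 1 ∨ σ = -1)
    (hz : HasSignPattern z k σ) (hAz : HasSignPattern (A.mulVec z) k σ) :
    0 < σ * A.mulVec z 0 := by
  by_contra! hle
  obtain ⟨r, hr, hpos⟩ := hAz.exists_strictMono hσ
  have hr0 : ∀ j, 0 < r j := fun j => by
    have h0 : 0 < r 0 := by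
      refine Fin.pos_iff_ne_zero.mpr fun h => ?_
      have := hpos 0
      rw [h] at this
      simp only [Fin.val_zero, pow_zero, mul_one] at this
      linarith
    exact h0.trans_le (hr.monotone (Fin.zero_le j))
  -- Prepend row 0 and drop the last row: the alternation now starts with `-σ`.
  have h1 := hA.sign_nonneg (τ := -σ) hσ hz
    (r := fun j => Fin.cases 0 (fun i => r i.castSucc) j) (fun j j' hj => ?_) fun j => ?_
  · rcases hσ with rfl | rfl <;> norm_num at h1
  · cases j using Fin.cases with
    | zero =>
      cases j' using Fin.cases with
      | zero => simp at hj
      | succ j' => exact hr0 _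
    | succ j =>
      cases j' using Fin.cases with
      | zero => simp at hj
      | succ j' => exact hr (by simpa using hj)
  · cases j using Fin.cases with
    | zero => simpa using hle
    | succ j => simpa [pow_succ] using (hpos j.castSucc).le

/-! ### Convergence of orbits. -/

/-- Along nonzero products of totally positive matrices, the first coordinate eventually has a
constant strict sign. -/
theorem eventually_first_coordinate_pos {n : ℕ} {z : ℕ → Fin (n + 1) → ℝ} (hz : ∀ t, z t ≠ 0)
    (hstep : ∀ t, ∃ M : Matrix (Fin (n + 1)) (Fin (n + 1)) ℝ,
      IsTotallyPositive M ∧ z (t + 1) = M.mulVec (z t)) :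
    ∃ σ : ℝ, (σ = 1 ∨ σ = -1) ∧ ∀ᶠ t in atTop, 0 < σ * z t 0 := by
  choose k σ hσ hpat using fun t => exists_hasSignPattern (z t) (hz t)
  choose M hM hzM using hstep
  have hanti : Antitone k := antitone_nat_of_succ_le fun t =>
    (hM t).hasSignPattern_le (hσ t) (hσ (t + 1)) (hpat t) (hzM t ▸ hpat (t + 1))
  obtain ⟨T, hT⟩ := WellFoundedLT.antitone_chain_condition hanti
  have hσT : ∀ t, T ≤ t → σ t = σ T := by
    intro t ht
    induction t, ht using Nat.le_induction with
    | base => rfl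
    | succ t ht ih =>
      rw [← ih]
      refine (hM t).hasSignPattern_sign_eq (hσ t) (hσ (t + 1)) (hpat t) ?_
      rw [← hzM t, ← hT t ht, hT (t + 1) (by omega)]
      exact hpat (t + 1)
  -- Strictness holds only for the image of a step, hence `T + 1`.
  refine ⟨σ T, hσ T, eventually_atTop.mpr ⟨T + 1, fun t ht => ?_⟩⟩
  obtain ⟨t, rfl⟩ : ∃ s, t = s + 1 := ⟨t - 1, by omega⟩
  have h1 := hpat (t + 1)
  rw [← hT (t + 1) (by omega), hT t (by omega), hσT (t + 1) (by omega), ← hσT t (by omega),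
    hzM t] at h1
  have h2 := (hM t).first_coordinate_pos (hσ t) (hpat t) h1
  rwa [hσT t (by omega), ← hzM t] at h2

/-- A map on a compact set whose increments are given by totally positive matrices has only
convergent orbits. -/
theorem exists_tendsto_of_increments {n : ℕ} {f : (Fin n → ℝ) → Fin n → ℝ} {Ω : Set (Fin n → ℝ)}
    (hΩ : IsCompact Ω) (hf : Continuous f) (hmaps : MapsTo f Ω Ω)
    (hinc : ∀ x ∈ Ω, ∀ y ∈ Ω, ∃ M : Matrix (Fin n) (Fin n) ℝ,
      IsTotallyPositive M ∧ f y - f x = M.mulVec (y - x))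
    {x : ℕ → Fin n → ℝ} (hx : ∀ k, x (k + 1) = f (x k)) (hx0 : x 0 ∈ Ω) :
    ∃ e ∈ Ω, f e = e ∧ Tendsto x atTop (𝓝 e) := by
  have hmem : ∀ {x : ℕ → Fin n → ℝ}, (∀ k, x (k + 1) = f (x k)) → x 0 ∈ Ω → ∀ k, x k ∈ Ω := by
    intro x hx hx0 k
    induction k with
    | zero => exact hx0
    | succ k ih => exact hx k ▸ hmaps ih
  by_cases hfix : ∃ k, x (k + 1) = x k
  · obtain ⟨T, hT⟩ := hfix
    refine ⟨x T, hmem hx hx0 T, by rw [← hx, hT], ?_⟩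
    refine tendsto_atTop_of_eventually_const (i₀ := T) fun t ht => ?_
    induction t, ht using Nat.le_induction with
    | base => rfl
    | succ t ht ih => rw [hx, ih, ← hx, hT]
  push Not at hfix
  cases n with
  | zero => exact (hfix 0 (Subsingleton.elim _ _)).elim
  | succ n =>
    have hsgn : ∀ {x : ℕ → Fin (n + 1) → ℝ}, (∀ k, x (k + 1) = f (x k)) → x 0 ∈ Ω →
        (∀ k, x (k + 1) ≠ x k) → ∃ σ : ℝ, (σ = 1 ∨ σ = -1) ∧
          ∀ᶠ t in atTop, 0 < σ * (x (t + 1) 0 - x t 0) := by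
      intro x hx hx0 hne
      refine eventually_first_coordinate_pos (z := fun t => x (t + 1) - x t)
        (fun t => sub_ne_zero.mpr (hne t)) fun t => ?_
      rw [hx (t + 1)]
      nth_rewrite 2 [hx t]
      exact hinc _ (hmem hx hx0 t) _ (hmem hx hx0 (t + 1))
    obtain ⟨c, hc⟩ : ∃ c, Tendsto (fun k => x k 0) atTop (𝓝 c) := by
      obtain ⟨σ, hσ, hev⟩ := hsgn hx hx0 hfix
      obtain ⟨T, hT⟩ := eventually_atTop.mp hev
      have hmono : Monotone fun k => σ * x (k + T) 0 := monotone_nat_of_le_succ fun k => by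
        have := hT (k + T) (by omega)
        rw [show k + 1 + T = k + T + 1 by omega]
        linarith
      have hbdd : BddAbove (range fun k => σ * x (k + T) 0) := by
        have hcont : Continuous fun y : Fin (n + 1) → ℝ => σ * y 0 := by fun_prop
        refine (hΩ.image hcont).bddAbove.mono ?_
        rintro _ ⟨k, rfl⟩
        exact ⟨_, hmem hx hx0 _, rfl⟩
      have h1 := tendsto_atTop_ciSup hmono hbdd
      have h2 := (h1.const_mul σ)
      refine ⟨_, (tendsto_add_atTop_iff_nat T).mp (h2.congr fun k => ?_)⟩
      rcases hσ with rfl | rfl <;> ring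
    have hclc : ∀ p, MapClusterPt p atTop x → p 0 = c := fun p hp => by
      obtain ⟨φ, hφ, hlim⟩ := hp.tendsto_subseq
      exact tendsto_nhds_unique ((continuous_apply 0).continuousAt.tendsto.comp hlim)
        (hc.comp hφ.tendsto_atTop)
    have hclf : ∀ p, MapClusterPt p atTop x → MapClusterPt (f p) atTop x := fun p hp => by
      have h1 := hp.continuousAt_comp hf.continuousAt
      have h2 : f ∘ x = x ∘ fun k => k + 1 := funext fun k => (hx k).symm
      rw [h2] at h1
      exact h1.of_comp (tendsto_add_atTop_nat 1)
    have hclmem : ∀ p, MapClusterPt p atTop x → p ∈ Ω := fun p hp =>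
      hΩ.isClosed.mem_of_mapClusterPt hp (Eventually.of_forall (hmem hx hx0))
    have hclfix : ∀ p, MapClusterPt p atTop x → f p = p := by
      intro p hp
      have hcl : ∀ k, MapClusterPt (f^[k] p) atTop x := fun k => by
        induction k with
        | zero => exact hp
        | succ k ih => rw [Function.iterate_succ_apply']; exact hclf _ ih
      have horb : ∀ k, f^[k + 1] p = f (f^[k] p) := fun k => Function.iterate_succ_apply' f k p
      by_contra hne
      have hinj : ∀ x ∈ Ω, ∀ y ∈ Ω, f y = f x → y = x := by
        intro x hx y hy h
        obtain ⟨M, hM, hMe⟩ := hinc x hx y hy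
        rw [h, sub_self] at hMe
        have hdet : M.det ≠ 0 := (hM.det_submatrix_pos strictMono_id strictMono_id).ne'
        exact sub_eq_zero.mp (Matrix.eq_zero_of_mulVec_eq_zero hdet hMe.symm)
      -- By injectivity the orbit of a non-fixed `p` never stops, so its first coordinate must
      -- eventually move; but it consists of cluster points.
      have hstep : ∀ k, f^[k + 1] p ≠ f^[k] p := by
        intro k
        induction k with
        | zero => exact hne
        | succ k ih =>
          intro h
          rw [horb (k + 1), horb k] at h
          refine ih ((horb k).trans ?_)
          exact hinj _ (hclmem _ (hcl k)) _ (hclmem _ (hclf _ (hcl k))) h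
      obtain ⟨σ, -, hev⟩ := hsgn (x := fun k => f^[k] p) horb (hclmem p hp) hstep
      obtain ⟨t, ht⟩ := hev.exists
      rw [hclc _ (hcl _), hclc _ (hcl _)] at ht
      simp at ht
    obtain ⟨e, he, hecl⟩ := hΩ.exists_mapClusterPt
      (f := atTop) (u := x) (Filter.tendsto_principal.mpr (Eventually.of_forall (hmem hx hx0)))
    refine ⟨e, he, hclfix e hecl, hΩ.tendsto_nhds_of_unique_mapClusterPt
      (Eventually.of_forall (hmem hx hx0)) fun q hq hqcl => ?_⟩
    by_contra hne
    obtain ⟨M, hM, hMe⟩ := hinc e he q hq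
    rw [hclfix e hecl, hclfix q hqcl] at hMe
    -- The difference of two fixed points is fixed by `M`, so it forms a constant sequence to which
    -- the sign lemma applies.
    obtain ⟨σ, -, hev⟩ := eventually_first_coordinate_pos (z := fun _ => q - e)
      (fun _ => sub_ne_zero.mpr hne) fun _ => ⟨M, hM, hMe⟩
    obtain ⟨t, ht⟩ := hev.exists
    simp [hclc _ hqcl, hclc _ hecl] at ht

/-! ### Perturbation bounds and the main theorem. -/

/-- Total positivity is an open condition. -/
theorem IsTotallyPositive.exists_pos_forall_abs_sub_le {m n : ℕ} {A : Matrix (Fin m) (Fin n) ℝ}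
    (hA : IsTotallyPositive A) :
    ∃ δ > 0, ∀ M : Matrix (Fin m) (Fin n) ℝ, (∀ i j, |M i j - A i j| ≤ δ) →
      IsTotallyPositive M := by
  have hminor : ∀ k : Fin (m + 1), ∀ r : Fin k → Fin m, ∀ c : Fin k → Fin n,
      StrictMono r → StrictMono c →
        ∀ᶠ M : Fin m → Fin n → ℝ in 𝓝 A, 0 < ((Matrix.of M).submatrix r c).det := by
    intro k r c hr hc
    have hcont : Continuous fun M : Fin m → Fin n → ℝ => ((Matrix.of M).submatrix r c).det := by
      refine Continuous.matrix_det (continuous_matrix fun i j => ?_)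
      exact (continuous_apply (c j)).comp (continuous_apply (r i))
    exact hcont.continuousAt.eventually (lt_mem_nhds (hA.det_submatrix_pos hr hc))
  have hall : ∀ᶠ M : Fin m → Fin n → ℝ in 𝓝 A, IsTotallyPositive (Matrix.of M) := by
    simp only [← eventually_all] at hminor
    filter_upwards [hminor] with M hM k r c
    have hk : k < m + 1 := by
      have := Fintype.card_le_of_injective r r.injective
      simp only [Fintype.card_fin] at this
      omega
    exact hM ⟨k, hk⟩ r c r.strictMono c.strictMono
  obtain ⟨δ, hδ, hball⟩ := Metric.nhds_basis_closedBall.eventually_iff.mp hall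
  refine ⟨δ, hδ, fun M hM => hball (x := M) ?_⟩
  exact (dist_pi_le_iff hδ.le).mpr fun i => (dist_pi_le_iff hδ.le).mpr fun j => hM i j

theorem signDiag_mul_mul_apply {n : ℕ} (X : Matrix (Fin n) (Fin n) ℝ) (i j : Fin n) :
    (signDiag n * X * signDiag n) i j = (-1) ^ (i : ℕ) * X i j * (-1) ^ (j : ℕ) := by
  simp [signDiag]

theorem abs_jacobianMatrix_le_jacobianBound {n : ℕ} {g : (Fin n → ℝ) → (Fin n → ℝ)}
    {Ω : Set (Fin n → ℝ)} (hg : ContDiff ℝ 1 g) (hΩ : IsCompact Ω) {x : Fin n → ℝ} (hx : x ∈ Ω)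
    (i j : Fin n) : |jacobianMatrix g x i j| ≤ jacobianBound g Ω i j :=
  (jacobianBound_isGreatest hg hΩ ⟨x, hx⟩ i j).2 ⟨x, hx, rfl⟩

theorem jacobianBound_nonneg {n : ℕ} (g : (Fin n → ℝ) → (Fin n → ℝ)) (Ω : Set (Fin n → ℝ))
    (i j : Fin n) : 0 ≤ jacobianBound g Ω i j := by
  refine Real.sSup_nonneg ?_
  rintro _ ⟨x, -, rfl⟩
  exact abs_nonneg _

theorem jacobianMatrix_perturbedMap {n : ℕ} (A : Matrix (Fin n) (Fin n) ℝ)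
    {g : (Fin n → ℝ) → (Fin n → ℝ)} (hg : ContDiff ℝ 1 g) (ε : ℝ) (x : Fin n → ℝ) :
    jacobianMatrix (perturbedMap A g ε) x = A + ε • jacobianMatrix g x := by
  have hd : DifferentiableAt ℝ g x := hg.differentiable one_ne_zero x
  have h1 : HasFDerivAt (perturbedMap A g ε)
      (A.mulVecLin.toContinuousLinearMap + ε • fderiv ℝ g x) x :=
    (A.mulVecLin.toContinuousLinearMap.hasFDerivAt (x := x)).add (hd.hasFDerivAt.const_smul ε)
  ext i j
  simp [jacobianMatrix, h1.fderiv]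

/-- Row-wise mean value theorem in matrix form. -/
theorem exists_matrix_sub_eq_mulVec {n : ℕ} {g : (Fin n → ℝ) → (Fin n → ℝ)}
    (hg : ContDiff ℝ 1 g) {Ω : Set (Fin n → ℝ)} (hconv : Convex ℝ Ω) {x y : Fin n → ℝ}
    (hx : x ∈ Ω) (hy : y ∈ Ω) :
    ∃ G : Matrix (Fin n) (Fin n) ℝ, g y - g x = G.mulVec (y - x) ∧
      ∀ i, ∃ ξ ∈ Ω, G i = jacobianMatrix g ξ i := by
  have hrow : ∀ i, ∃ ξ ∈ Ω, g y i - g x i = fderiv ℝ g ξ (y - x) i := by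
    intro i
    obtain ⟨ξ, hξ, h⟩ := domain_mvt (f := fun u => g u i) (s := Ω)
      (f' := fun u => (ContinuousLinearMap.proj i).comp (fderiv ℝ g u))
      (fun u _ => (hasFDerivAt_pi'.mp
        (hg.differentiable one_ne_zero u).hasFDerivAt i).hasFDerivWithinAt) hconv hx hy
    exact ⟨ξ, hconv.segment_subset hx hy hξ, h⟩
  choose ξ hξ h using hrow
  refine ⟨fun i => jacobianMatrix g (ξ i) i, ?_, fun i => ⟨ξ i, hξ i, rfl⟩⟩
  ext i
  rw [Pi.sub_apply, h i]
  conv_lhs => rw [pi_eq_sum_univ' (y - x)]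
  simp [Matrix.mulVec, dotProduct, jacobianMatrix, mul_comm]

theorem mainTheorem6 (n : ℕ) (A : Matrix (Fin n) (Fin n) ℝ) (g : (Fin n → ℝ) → (Fin n → ℝ))
    (Ω : Set (Fin n → ℝ)) (hA : IsTotallyPositive A) (hg : ContDiff ℝ 1 g)
    (hΩ : IsCompact Ω) (hconv : Convex ℝ Ω) :
    ∃ w : ℝ, 0 < w ∧
      (∀ v ∈ Set.Ico 0 w,
        IsTotallyPositive (lowerMatrix A (jacobianBound g Ω) v) ∧
        IsTotallyPositive (upperMatrix A (jacobianBound g Ω) v) ∧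
        ∀ ε ∈ Set.Icc 0 v, ∀ x ∈ Ω,
          CheckerboardLE (lowerMatrix A (jacobianBound g Ω) v)
            (jacobianMatrix (perturbedMap A g ε) x) ∧
          CheckerboardLE (jacobianMatrix (perturbedMap A g ε) x)
            (upperMatrix A (jacobianBound g Ω) v)) ∧
      (∀ ε ∈ Set.Ico 0 w, Set.MapsTo (perturbedMap A g ε) Ω Ω →
        ∀ x : ℕ → Fin n → ℝ, (∀ k, x (k + 1) = perturbedMap A g ε (x k)) → x 0 ∈ Ω →
          ∃ e ∈ Ω, perturbedMap A g ε e = e ∧ Filter.Tendsto x Filter.atTop (nhds e)) := by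

  obtain ⟨δ, hδ, hTP⟩ := hA.exists_pos_forall_abs_sub_le
  set B := jacobianBound g Ω
  have hB : ∀ i j, 0 ≤ B i j := jacobianBound_nonneg g Ω
  have hsum : 0 ≤ ∑ i, ∑ j, B i j := Finset.sum_nonneg fun i _ => Finset.sum_nonneg fun j _ => hB i j
  have hle : ∀ i j, B i j ≤ 1 + ∑ i, ∑ j, B i j := fun i j => by
    have h1 := Finset.single_le_sum (fun j _ => hB i j) (Finset.mem_univ j)
    have h2 := Finset.single_le_sum (f := fun i => ∑ j, B i j)
      (fun i _ => Finset.sum_nonneg fun j _ => hB i j) (Finset.mem_univ i)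
    exact (h1.trans h2).trans (by linarith)
  have hJ : ∀ x ∈ Ω, ∀ i j, |jacobianMatrix g x i j| ≤ B i j := fun x hx =>
    abs_jacobianMatrix_le_jacobianBound hg hΩ hx
  have hsmall : ∀ v ∈ Set.Ico 0 (δ / (1 + ∑ i, ∑ j, B i j)), ∀ i j, v * B i j ≤ δ := by
    rintro v ⟨hv0, hv⟩ i j
    rw [lt_div_iff₀ (by linarith)] at hv
    exact (mul_le_mul_of_nonneg_left (hle i j) hv0).trans hv.le
  -- The sum dominates every entry of `B`; the 1 keeps the denominator positive when `B = 0`.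
  refine ⟨δ / (1 + ∑ i, ∑ j, B i j), div_pos hδ (by linarith), fun v hv => ⟨?_, ?_, ?_⟩, ?_⟩
  · refine hTP _ fun i j => le_trans (le_of_eq ?_) (hsmall v hv i j)
    simp [lowerMatrix, signDiag_mul_mul_apply, abs_mul, abs_of_nonneg hv.1, abs_of_nonneg (hB i j)]
  · refine hTP _ fun i j => le_trans (le_of_eq ?_) (hsmall v hv i j)
    simp [upperMatrix, signDiag_mul_mul_apply, abs_mul, abs_of_nonneg hv.1, abs_of_nonneg (hB i j)]
  · intro ε hε x hx
    rw [jacobianMatrix_perturbedMap A hg]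
    have hεJ : ∀ i j : Fin n, |(-1) ^ (i : ℕ) * (ε * jacobianMatrix g x i j) * (-1) ^ (j : ℕ)|
        ≤ v * B i j := fun i j => by
      simp only [abs_mul, abs_pow, abs_neg, abs_one, one_pow, one_mul, mul_one,
        abs_of_nonneg hε.1]
      exact mul_le_mul hε.2 (hJ x hx i j) (abs_nonneg _) hv.1
    have hsq : ∀ (i j : Fin n) (b : ℝ), (-1) ^ (i : ℕ) *
        ((-1) ^ (i : ℕ) * b * (-1) ^ (j : ℕ)) * (-1) ^ (j : ℕ) = b := fun i j b => by
      rcases neg_one_pow_eq_or ℝ (i : ℕ) with h | h <;>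
        rcases neg_one_pow_eq_or ℝ (j : ℕ) with h' | h' <;> simp [h, h']
    constructor <;> intro i j <;>
      simp only [signDiag_mul_mul_apply, lowerMatrix, upperMatrix, Matrix.sub_apply,
        Matrix.add_apply, Matrix.smul_apply, smul_eq_mul] <;>
      have h1 := abs_le.mp (hεJ i j) <;> have h2 := hsq i j (B i j)
    · linear_combination h1.1 - v * h2
    · linear_combination h1.2 - v * h2
  · intro ε hε hmaps x hx hx0
    refine exists_tendsto_of_increments hΩ ?_ hmaps ?_ hx hx0
    · exact (Continuous.matrix_mulVec continuous_const continuous_id).add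
        (hg.continuous.const_smul ε)
    · intro y hy z hz
      obtain ⟨G, hG, hrow⟩ := exists_matrix_sub_eq_mulVec hg hconv hy hz
      -- The rows of `G` come from different points, so it need not be a Jacobian; the entrywise
      -- bound by `B` suffices.
      refine ⟨A + ε • G, hTP _ fun i j => ?_, ?_⟩
      · obtain ⟨ξ, hξ, hGi⟩ := hrow i
        refine le_trans ?_ (hsmall ε hε i j)
        simpa [abs_mul, abs_of_nonneg hε.1, hGi] using
          mul_le_mul_of_nonneg_left (hJ ξ hξ i j) hε.1
      · rw [Matrix.add_mulVec, Matrix.smul_mulVec, ← hG, Matrix.mulVec_sub]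
        simp only [perturbedMap, smul_sub]
        abel
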